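/- Let $\mathcal{D}'(\mathbb{R})$ be the space of complex-valued distributions on $\mathbb{R}$, let $\delta_0$ be the Dirac distribution at $0$, and let $\theta$ be the Heaviside function ($\theta(t)=1$ for $t>0$, $\theta(t)=0$ for $t<0$). For $u\in\mathcal{D}'(\mathbb{R})$, $t u$ denotes the product of $u$ with the smooth function $t\mapsto t$. Let $t_+^{-1}, t_-^{-1}\in\mathcal{D}'(\mathbb{R})$ be given by $$\langle t_+^{-1},\psi\rangle=-\int_0^\infty \log(t)\,\psi'(t)\,dt,\qquad \langle t_-^{-1},\psi\rangle=-\int_{-\infty}^0 \log|t|\,\psi'(t)\,dt,$$ i.e. they are the distributional derivatives of $\theta(t)\log|t|$ and $\theta(-t)\log|t|$; thus $t_\pm^{-1}$ equals $1/t$ for $\pm t>0$ and vanishes for $\pm t<0$. Then: 1. A distribution $u\in\mathcal{D}'(\mathbb{R})$ satisfies $t u'+u=\delta_0$ if and only if there are $c,a_0\in\mathbb{C}$ with $$u=c\,t_+^{-1}+(c-1)\,t_-^{-1}+a_0\,\delta_0 .$$ 2. For all $c,a_0\in\mathbb{C}$, $\;t\,\bigl(c\,t_+^{-1}+(c-1)\,t_-^{-1}+a_0\delta_0\bigr)=\theta+(c-1)$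 in $\mathcal{D}'(\mathbb{R})$. 3. Consequently, if $\varphi\in\mathcal{D}'(\mathbb{R})$ satisfies $\xi\varphi'+\varphi=\delta_0$, then $\Upsilon:=\xi\varphi$ equals $\theta+d$ for some constant $d\in\mathbb{C}$; moreover $\Upsilon=\theta$ if and only if $d=0$, and this is the case if and only if $\Upsilon=1$ on $(0,\infty)$ (in the sense of distributions). Conversely, for every $d\in\mathbb{C}$ there is a solution $\varphi\in\mathcal{D}'(\mathbb{R})$ of $\xi\varphi'+\varphi=\delta_0$ with $\xi\varphi=\theta+d$. -/

import Mathlib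

open MeasureTheory Set
open scoped Distributions LineDeriv ContDiff

noncomputable section

namespace EulerDistribution

/-- The space of test functions on the real line: smooth functions with compact support. A complex
distribution is determined by its values on the real-valued test functions. -/
abbrev TestFun : Type := 𝓓((⊤ : TopologicalSpace.Opens ℝ), ℝ)

/-- The space of complex-valued distributions on the real line. Its derivative `u'` is Mathlib's
directional derivative `∂_{(1 : ℝ)} u`, that is `u'(ψ) = - u(ψ')`. -/
abbrev Distr : Type := 𝓓'((⊤ : TopologicalSpace.Opens ℝ), ℂ)

/-- The regular distribution `ψ ↦ ∫ ψ(t) f(t) dt` of a locally integrable function `f`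
(it is zero by convention if `f` is not locally integrable). -/
def regular (f : ℝ → ℂ) : Distr :=
  UniformConvergenceCLM.ofFun (RingHom.id ℝ) ℂ {S | IsCompact S}
    (TestFunction.integralAgainstBilinCLM (ContinuousLinearMap.lsmul ℝ ℝ) volume f)

theorem regular_apply {f : ℝ → ℂ} (hf : LocallyIntegrable f) (ψ : TestFun) :
    regular f ψ = ∫ t, (ψ t : ℂ) * f t := by
  have h : LocallyIntegrableOn f ((⊤ : TopologicalSpace.Opens ℝ) : Set ℝ) volume :=
    hf.locallyIntegrableOn _
  refine (TestFunction.integralAgainstBilinCLM_eq_integral h).trans ?_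
  simp

/-- Multiplication `ψ ↦ g ψ` of test functions by a smooth function `g`. -/
def mulTest (g : ℝ → ℝ) (hg : ContDiff ℝ ∞ g) : TestFun →L[ℝ] TestFun :=
  TestFunction.limitCLM ℝ
    (fun ψ ↦ ⟨fun t ↦ g t * ψ t, hg.mul ψ.contDiff, ψ.hasCompactSupport.mul_left,
      (tsupport_mul_subset_right).trans ψ.tsupport_subset⟩)
    (fun K hK ↦ TestFunction.ofSupportedInCLM ℝ hK ∘L
      ContDiffMapSupportedIn.bilinLeftCLM (ContinuousLinearMap.mul ℝ ℝ) hg)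
    (fun K hK ψ ↦ by ext t; simp [mul_comm])

/-- The product `g u` of a smooth function and a distribution: `(g u)(ψ) = u(g ψ)`. -/
def smoothMul (g : ℝ → ℝ) (hg : ContDiff ℝ ∞ g) : Distr →L[ℝ] Distr :=
  (mulTest g hg).precompCompactConvergenceCLM ℂ

/-- The product `t u` of the distribution `u` with the identity function `t ↦ t`. -/
def tMul (u : Distr) : Distr := smoothMul (fun t ↦ t) contDiff_id u

theorem tMul_apply (u : Distr) (ψ : TestFun) :
    tMul u ψ = u (mulTest (fun t ↦ t) contDiff_id ψ) := rfl

theorem mulTest_apply (g : ℝ → ℝ) (hg : ContDiff ℝ ∞ g) (ψ : TestFun) (t : ℝ) :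
    mulTest g hg ψ t = g t * ψ t := rfl

/-- The Dirac distribution at the origin. -/
def dirac : Distr := Distribution.mapCLM Complex.ofRealCLM (Distribution.delta (0 : ℝ))

/-- The Heaviside function. -/
def heavisideFun (t : ℝ) : ℂ := if 0 < t then 1 else 0

theorem heavisideFun_mul_locallyIntegrable {f : ℝ → ℂ} (hf : LocallyIntegrable f) :
    LocallyIntegrable (fun t ↦ heavisideFun t * f t) ∧
      LocallyIntegrable (fun t ↦ heavisideFun (-t) * f t) := by
  constructor
  · have h : (fun t ↦ heavisideFun t * f t) = (Ioi (0 : ℝ)).indicator f := by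
      ext t; simp [heavisideFun, indicator]
    rw [h]
    exact hf.indicator measurableSet_Ioi
  · have h : (fun t ↦ heavisideFun (-t) * f t) = (Iio (0 : ℝ)).indicator f := by
      ext t; simp [heavisideFun, indicator]
    rw [h]
    exact hf.indicator measurableSet_Iio

theorem log_abs_locallyIntegrable : LocallyIntegrable (fun t : ℝ ↦ (Real.log |t| : ℂ)) := by
  rw [locallyIntegrable_iff]
  intro K hK
  obtain ⟨R, hR⟩ := hK.isBounded.subset_closedBall 0
  rw [Real.closedBall_eq_Icc] at hR
  refine IntegrableOn.mono_set ?_ (hR.trans Icc_subset_uIcc)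
  have h := intervalIntegral.intervalIntegrable_log' (a := 0 - R) (b := 0 + R)
  rw [intervalIntegrable_iff'] at h
  have h' : IntegrableOn (fun t ↦ (Real.log t : ℂ)) (uIcc (0 - R) (0 + R)) := h.ofReal
  simpa using h'

/-- The Heaviside function, as a distribution. -/
def heaviside : Distr := regular heavisideFun

/-- The constant `d`, as a distribution. -/
def constDistr (d : ℂ) : Distr := regular (fun _ ↦ d)

/-- The distribution `t₊⁻¹`, i.e. the distributional derivative of `θ(t) log t`:
`t₊⁻¹(ψ) = - ∫_0^∞ log t ψ'(t) dt`. It equals `1 / t` on `t > 0` and vanishes on `t < 0`. -/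
def tPosInv : Distr := ∂_{(1 : ℝ)} (regular (fun t ↦ heavisideFun t * (Real.log |t| : ℂ)))

/-- The distribution `t₋⁻¹`, i.e. the distributional derivative of `θ(-t) log |t|`:
`t₋⁻¹(ψ) = - ∫_{-∞}^0 log |t| ψ'(t) dt`. It equals `1 / t` on `t < 0` (not `1 / |t|`) and vanishes
on `t > 0`. -/
def tNegInv : Distr := ∂_{(1 : ℝ)} (regular (fun t ↦ heavisideFun (-t) * (Real.log |t| : ℂ)))

theorem tPosInv_apply (ψ : TestFun) :
    tPosInv ψ = - ∫ t in Ioi (0 : ℝ), (Real.log t : ℂ) * ((deriv ψ t : ℝ) : ℂ) := by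
  rw [tPosInv, Distribution.lineDerivOp_apply_apply, map_neg,
    regular_apply (heavisideFun_mul_locallyIntegrable log_abs_locallyIntegrable).1,
    ← integral_indicator measurableSet_Ioi]
  congr 2
  ext t
  have h : (∂_{(1 : ℝ)} ψ) t = deriv ψ t := by
    rw [TestFunction.lineDerivOp_eq_lineDerivCLM ℝ,
      TestFunction.lineDerivCLM_apply_of_le (by simp)]
    simp [lineDeriv, deriv_comp_const_add]
  by_cases ht : 0 < t <;> simp [h, heavisideFun, ht, mul_comm]

theorem tNegInv_apply (ψ : TestFun) :
    tNegInv ψ = - ∫ t in Iio (0 : ℝ), (Real.log |t| : ℂ) * ((deriv ψ t : ℝ) : ℂ) := by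
  rw [tNegInv, Distribution.lineDerivOp_apply_apply, map_neg,
    regular_apply (heavisideFun_mul_locallyIntegrable log_abs_locallyIntegrable).2,
    ← integral_indicator measurableSet_Iio]
  congr 2
  ext t
  have h : (∂_{(1 : ℝ)} ψ) t = deriv ψ t := by
    rw [TestFunction.lineDerivOp_eq_lineDerivCLM ℝ,
      TestFunction.lineDerivCLM_apply_of_le (by simp)]
    simp [lineDeriv, deriv_comp_const_add]
  by_cases ht : t < 0 <;> simp [h, heavisideFun, ht, mul_comm]

end EulerDistribution

end

open EulerDistribution

namespace EulerDistribution

open Filter Topology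

/-! By the product rule `t u' + u = (t u)'`, so the equation says that `t u` is a primitive of `δ₀`.
Since `θ' = δ₀` and only constants have zero derivative, this means `t u = θ + d`. Integration by
parts gives `t t₊⁻¹ = θ` and `t t₋⁻¹ = 1 - θ`, hence `(d + 1) t₊⁻¹ + d t₋⁻¹` is a particular
solution, and two solutions differ by an element of the kernel of multiplication by `t`, which is
spanned by `δ₀`.

Both kernels are found by duality: subtracting from `ψ` a multiple of a fixed test function leaves
something in the range of `d/dt` (integral zero) or of multiplication by `t` (value zero at `0`,
Hadamard's lemma). -/

/-! ### Hadamard's lemma and compactly supported primitives -/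

/-- Differentiation under the integral sign for `x ↦ ∫₀¹ tᵏ f(t x) dt`. -/
theorem hasDerivAt_integral_pow_mul_comp_mul {f : ℝ → ℝ} (hf : ContDiff ℝ 1 f) (k : ℕ) (x : ℝ) :
    HasDerivAt (fun x ↦ ∫ t in (0 : ℝ)..1, t ^ k * f (t * x))
      (∫ t in (0 : ℝ)..1, t ^ (k + 1) * deriv f (t * x)) x := by
  have hc : Continuous f := hf.continuous
  have hd : Continuous (deriv f) := hf.continuous_deriv le_rfl
  have hK : IsCompact (Metric.closedBall x 1 ×ˢ Icc (0 : ℝ) 1) :=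
    (isCompact_closedBall x 1).prod isCompact_Icc
  obtain ⟨C, hC⟩ := hK.exists_bound_of_continuousOn
    (f := fun p : ℝ × ℝ ↦ p.2 ^ (k + 1) * deriv f (p.2 * p.1)) (by fun_prop)
  refine (intervalIntegral.hasDerivAt_integral_of_dominated_loc_of_deriv_le
    (F' := fun x t ↦ t ^ (k + 1) * deriv f (t * x)) (bound := fun _ ↦ C)
    (Metric.closedBall_mem_nhds x one_pos) ?_ ?_ ?_ ?_ ?_ ?_).2
  · exact Eventually.of_forall fun y ↦ Continuous.aestronglyMeasurable (by fun_prop)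
  · exact Continuous.intervalIntegrable (by fun_prop) _ _
  · exact Continuous.aestronglyMeasurable (by fun_prop)
  · refine Eventually.of_forall fun t ht y hy ↦ hC (y, t) ⟨hy, ?_⟩
    rw [uIoc_of_le zero_le_one] at ht
    exact Ioc_subset_Icc_self ht
  · exact intervalIntegrable_const
  · refine Eventually.of_forall fun t _ y _ ↦ ?_
    have h1 : HasDerivAt (fun y ↦ f (t * y)) (deriv f (t * y) * t) y := by
      have := (hf.differentiable one_ne_zero (t * y)).hasDerivAt
      exact this.comp y (by simpa using (hasDerivAt_id y).const_mul t)
    convert! h1.const_mul (t ^ k) using 1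
    ring

/-- Differentiating in `x` replaces `f` by `deriv f` and `k` by `k + 1`; the weight `t ^ k` makes
this family closed under differentiation, so induction applies. -/
theorem contDiff_integral_pow_mul_comp_mul {f : ℝ → ℝ} (hf : ContDiff ℝ ∞ f) (k : ℕ) :
    ContDiff ℝ ∞ (fun x ↦ ∫ t in (0 : ℝ)..1, t ^ k * f (t * x)) := by
  rw [contDiff_infty]
  intro n
  induction n generalizing f k with
  | zero =>
    refine contDiff_zero.2 (continuous_iff_continuousAt.2 fun x ↦ ?_)
    exact (hasDerivAt_integral_pow_mul_comp_mul (hf.of_le (by simp)) k x).continuousAt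
  | succ n ih =>
    have h := hasDerivAt_integral_pow_mul_comp_mul (hf.of_le (by simp)) k
    rw [Nat.cast_succ, contDiff_succ_iff_deriv]
    refine ⟨fun x ↦ (h x).differentiableAt, fun hn ↦ by simp at hn, ?_⟩
    rw [funext fun x ↦ (h x).deriv]
    exact ih (contDiff_infty_iff_deriv.1 hf).2 (k + 1)

/-- Hadamard's lemma: a smooth function vanishing at `0` is `x` times a smooth function. -/
theorem exists_contDiff_eq_mul_of_apply_zero {f : ℝ → ℝ} (hf : ContDiff ℝ ∞ f) (h0 : f 0 = 0) :
    ∃ g : ℝ → ℝ, ContDiff ℝ ∞ g ∧ ∀ x, f x = x * g x := by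
  have hd := (contDiff_infty_iff_deriv.1 hf).2
  -- `x * g x` is the integral of the `t`-derivative of `f (t * x)`, namely `f x - f 0`.
  refine ⟨fun x ↦ ∫ t in (0 : ℝ)..1, t ^ 0 * deriv f (t * x),
    contDiff_integral_pow_mul_comp_mul hd 0, fun x ↦ ?_⟩
  have h := intervalIntegral.integral_eq_sub_of_hasDerivAt (a := 0) (b := 1)
    (f := fun t ↦ f (t * x)) (f' := fun t ↦ x * deriv f (t * x)) (fun t _ ↦ by
      have h1 := ((hf.differentiable (by simp)) (t * x)).hasDerivAt
      have h2 : HasDerivAt (fun t ↦ t * x) x t := by simpa using (hasDerivAt_id t).mul_const x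
      simpa [mul_comm] using! h1.comp t h2)
    (Continuous.intervalIntegrable (by have := hd.continuous; fun_prop) _ _)
  simpa [h0, eq_comm] using h

/-- A compactly supported smooth function with integral zero has a compactly supported smooth
primitive. -/
theorem exists_hasDerivAt_of_integral_eq_zero {f : ℝ → ℝ} (hf : ContDiff ℝ ∞ f)
    (hc : HasCompactSupport f) (h0 : ∫ t, f t = 0) :
    ∃ g : ℝ → ℝ, ContDiff ℝ ∞ g ∧ HasCompactSupport g ∧ deriv g = f := by
  obtain ⟨R, hR⟩ := hc.isCompact.isBounded.subset_ball 0
  rw [Real.ball_eq_Ioo, zero_sub, zero_add] at hR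
  have hs : Function.support f ⊆ Ioo (-R) R := (subset_tsupport f).trans hR
  have hz : ∀ t, t ∉ Ioo (-R) R → f t = 0 := fun t ht ↦ by
    by_contra h
    exact ht (hs h)
  have hd : ∀ x, HasDerivAt (fun x ↦ ∫ t in (-R)..x, f t) (f x) x := fun x ↦
    hf.continuous.integral_hasStrictDerivAt (-R) x |>.hasDerivAt
  have hde := funext fun x ↦ (hd x).deriv
  refine ⟨fun x ↦ ∫ t in (-R)..x, f t, ?_, ?_, hde⟩
  · exact contDiff_infty_iff_deriv.2 ⟨fun x ↦ (hd x).differentiableAt, by rwa [hde]⟩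
  -- Left of `-R` the integrand vanishes; right of `R` the primitive is the full integral, which is
  -- zero.
  · refine HasCompactSupport.intro (isCompact_Icc (a := -R) (b := R)) fun x hx ↦ ?_
    rcases lt_or_ge x (-R) with h | h
    · refine intervalIntegral.integral_zero_ae (Eventually.of_forall fun t ht ↦ hz t fun ht' ↦ ?_)
      rw [uIoc_of_ge h.le] at ht
      exact absurd ht.2 (not_le.2 ht'.1)
    · have hx' : R < x := by
        by_contra h'
        exact hx ⟨h, not_lt.1 h'⟩
      rw [intervalIntegral.integral_eq_integral_of_support_subset, h0]
      exact hs.trans fun t ht ↦ ⟨ht.1, (ht.2.trans hx').le⟩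

/-! ### Test functions and the kernels of `t` and `d/dt` -/

theorem lineDerivOp_testFun_apply (ψ : TestFun) (t : ℝ) : (∂_{(1 : ℝ)} ψ) t = deriv ψ t := by
  rw [TestFunction.lineDerivOp_eq_lineDerivCLM ℝ, TestFunction.lineDerivCLM_apply_of_le (by simp)]
  simp [lineDeriv, deriv_comp_const_add]

theorem TestFun.hasDerivAt (ψ : TestFun) (t : ℝ) : HasDerivAt ψ (deriv ψ t) t :=
  (ψ.contDiff.differentiable (by simp) t).hasDerivAt

theorem TestFun.integrable (ψ : TestFun) : Integrable ψ :=
  ψ.continuous.integrable_of_hasCompactSupport ψ.hasCompactSupport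

theorem dirac_apply (ψ : TestFun) : dirac ψ = (ψ 0 : ℂ) := rfl

/-- There is a test function supported in `(0, ∞)` with integral one. -/
theorem exists_testFun_integral_eq_one :
    ∃ χ : TestFun, tsupport χ ⊆ Ioi 0 ∧ ∫ t, χ t = 1 := by
  let b : ContDiffBump (2 : ℝ) := ⟨1 / 2, 1, by norm_num, by norm_num⟩
  refine ⟨⟨b.normed volume, b.contDiff_normed, b.hasCompactSupport_normed, subset_univ _⟩, ?_,
    b.integral_normed⟩
  change tsupport (b.normed volume) ⊆ Ioi 0
  rw [b.tsupport_normed_eq, Real.closedBall_eq_Icc]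
  intro t ht
  have : (2 : ℝ) - 1 ≤ t := ht.1
  exact lt_of_lt_of_le (by norm_num) this

theorem exists_testFun_apply_zero_eq_one : ∃ χ : TestFun, χ 0 = 1 := by
  let b : ContDiffBump (0 : ℝ) := ⟨1, 2, by norm_num, by norm_num⟩
  exact ⟨⟨b, b.contDiff, b.hasCompactSupport, subset_univ _⟩,
    b.one_of_mem_closedBall (Metric.mem_closedBall_self zero_le_one)⟩

/-- A distribution killed by multiplication with `t` is a multiple of the Dirac distribution. -/
theorem exists_eq_smul_dirac_of_tMul_eq_zero {u : Distr} (hu : tMul u = 0) :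
    ∃ a : ℂ, u = a • dirac := by
  obtain ⟨χ, hχ⟩ := exists_testFun_apply_zero_eq_one
  refine ⟨u χ, ?_⟩
  ext ψ
  set η : TestFun := ψ - ψ 0 • χ with hη
  obtain ⟨g, hg, hgη⟩ := exists_contDiff_eq_mul_of_apply_zero η.contDiff (by simp [hη, hχ])
  have hgc : HasCompactSupport g := by
    -- The point `0` is adjoined because `η x = x * g x` does not control `g 0`.
    refine HasCompactSupport.intro
      (η.hasCompactSupport.isCompact.union (isCompact_singleton (x := 0))) fun x hx ↦ ?_
    rw [mem_union, not_or] at hx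
    have h := hgη x
    rw [image_eq_zero_of_notMem_tsupport hx.1] at h
    exact (mul_eq_zero.1 h.symm).resolve_left hx.2
  have h : u η = 0 := by
    have h1 := congr($hu ⟨g, hg, hgc, subset_univ _⟩)
    rw [tMul_apply] at h1
    convert! h1 using 2
    ext t
    exact hgη t
  rw [hη, map_sub, map_smul, sub_eq_zero] at h
  change u ψ = u χ * dirac ψ
  rw [h, dirac_apply, Complex.real_smul, mul_comm]

/-- A distribution with zero derivative is constant. -/
theorem exists_eq_constDistr_of_lineDerivOp_eq_zero {u : Distr} (hu : ∂_{(1 : ℝ)} u = 0) :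
    ∃ d : ℂ, u = constDistr d := by
  obtain ⟨χ, -, hχ⟩ := exists_testFun_integral_eq_one
  refine ⟨u χ, ?_⟩
  ext ψ
  set η : TestFun := ψ - (∫ t, ψ t) • χ with hη
  obtain ⟨g, hg, hgc, hgd⟩ := exists_hasDerivAt_of_integral_eq_zero η.contDiff η.hasCompactSupport
    (by
      simp only [hη, FunLike.coe_sub, FunLike.coe_smul, Pi.sub_apply, Pi.smul_apply, smul_eq_mul]
      rw [integral_sub (TestFun.integrable ψ) ((TestFun.integrable χ).const_mul _),
        integral_const_mul, hχ, mul_one, sub_self])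
  have h : u η = 0 := by
    have h1 := congr($hu ⟨g, hg, hgc, subset_univ _⟩)
    rw [Distribution.lineDerivOp_apply_apply, map_neg] at h1
    have h2 : ∂_{(1 : ℝ)} (⟨g, hg, hgc, subset_univ _⟩ : TestFun) = η := by
      ext t
      rw [lineDerivOp_testFun_apply]
      exact congr($hgd t)
    simpa [h2] using h1
  rw [hη, map_sub, map_smul, sub_eq_zero] at h
  rw [h, constDistr, regular_apply (locallyIntegrable_const _), integral_mul_const,
    integral_complex_ofReal, Complex.real_smul]

/-- The product rule `(t u)' = t u' + u`. -/
theorem lineDerivOp_tMul (u : Distr) :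
    ∂_{(1 : ℝ)} (tMul u) = tMul (∂_{(1 : ℝ)} u) + u := by
  ext ψ
  have h : ∂_{(1 : ℝ)} (mulTest (fun t ↦ t) contDiff_id ψ) =
      mulTest (fun t ↦ t) contDiff_id (∂_{(1 : ℝ)} ψ) + ψ := by
    ext t
    rw [lineDerivOp_testFun_apply, FunLike.coe_add, Pi.add_apply, mulTest_apply,
      lineDerivOp_testFun_apply]
    have := (hasDerivAt_id t).mul (TestFun.hasDerivAt ψ t)
    refine (this.deriv).trans ?_
    simp [add_comm]
  change _ = tMul (∂_{(1 : ℝ)} u) ψ + u ψ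
  rw [Distribution.lineDerivOp_apply_apply, tMul_apply, tMul_apply,
    Distribution.lineDerivOp_apply_apply, h]
  simp

/-! ### Derivatives of `θ` and of constants -/

theorem heavisideFun_locallyIntegrable : LocallyIntegrable heavisideFun := by
  simpa using (heavisideFun_mul_locallyIntegrable (locallyIntegrable_const (1 : ℂ))).1

theorem heaviside_apply (ψ : TestFun) : heaviside ψ = ((∫ t in Ioi (0 : ℝ), ψ t : ℝ) : ℂ) := by
  rw [heaviside, regular_apply heavisideFun_locallyIntegrable, ← integral_complex_ofReal,
    ← integral_indicator measurableSet_Ioi]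
  congr 1
  ext t
  by_cases ht : 0 < t <;> simp [heavisideFun, ht]

theorem constDistr_apply (d : ℂ) (ψ : TestFun) : constDistr d ψ = d * ((∫ t, ψ t : ℝ) : ℂ) := by
  rw [constDistr, regular_apply (locallyIntegrable_const _), integral_mul_const,
    integral_complex_ofReal, mul_comm]

theorem lineDerivOp_heaviside : ∂_{(1 : ℝ)} heaviside = dirac := by
  ext ψ
  rw [Distribution.lineDerivOp_apply_apply, map_neg, heaviside_apply, dirac_apply]
  simp_rw [lineDerivOp_testFun_apply]
  rw [ψ.hasCompactSupport.integral_Ioi_deriv_eq (ψ.contDiff.of_le (by simp))]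
  simp

theorem lineDerivOp_constDistr (d : ℂ) : ∂_{(1 : ℝ)} (constDistr d) = 0 := by
  ext ψ
  rw [Distribution.lineDerivOp_apply_apply, map_neg, constDistr_apply]
  simp_rw [lineDerivOp_testFun_apply]
  have : ∫ t, deriv ψ t = 0 := by
    refine integral_eq_zero_of_hasDerivAt_of_integrable (TestFun.hasDerivAt ψ) ?_
      (TestFun.integrable ψ)
    exact (ψ.contDiff.continuous_deriv (by simp)).integrable_of_hasCompactSupport
      ψ.hasCompactSupport.deriv
  simp [this]

/-! ### The products `t t₊⁻¹` and `t t₋⁻¹` -/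

theorem integrable_log_mul (ψ : TestFun) : Integrable (fun t ↦ Real.log t * ψ t) := by
  have h := (TestFunction.integrable_bilin (ContinuousLinearMap.lsmul ℝ ℝ)
    (log_abs_locallyIntegrable.locallyIntegrableOn ((⊤ : TopologicalSpace.Opens ℝ) : Set ℝ)) ψ).re
  simpa [mul_comm] using h

/-- The derivative of `t log|t| ψ(t)` away from the origin. -/
theorem hasDerivAt_mul_log_mul (ψ : TestFun) {t : ℝ} (ht : t ≠ 0) :
    HasDerivAt (fun t ↦ t * Real.log t * ψ t)
      (Real.log t * deriv (mulTest (fun t ↦ t) contDiff_id ψ) t + ψ t) t := by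
  have h1 := TestFun.hasDerivAt (mulTest (fun t ↦ t) contDiff_id ψ) t
  have h2 := (Real.hasDerivAt_log ht).mul h1
  convert! h2 using 1
  · ext s
    simp only [Pi.mul_apply, mulTest_apply]
    ring
  · rw [mulTest_apply]
    field_simp
    ring

theorem integrable_log_mul_deriv_mulTest (ψ : TestFun) :
    Integrable (fun t ↦ Real.log t * deriv (mulTest (fun t ↦ t) contDiff_id ψ) t) := by
  simpa only [lineDerivOp_testFun_apply] using
    integrable_log_mul (∂_{(1 : ℝ)} (mulTest (fun t ↦ t) contDiff_id ψ))

theorem hasCompactSupport_mul_log_mul (ψ : TestFun) :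
    HasCompactSupport (fun t ↦ t * Real.log t * ψ t) :=
  ψ.hasCompactSupport.mul_left (f := fun t ↦ t * Real.log t)

/-- Continuity at `0` allows integrating up to the origin, where the derivative formula fails. -/
theorem continuous_mul_log_mul (ψ : TestFun) : Continuous (fun t ↦ t * Real.log t * ψ t) :=
  Real.continuous_mul_log.mul ψ.continuous

/-- The derivative `log t (tψ)' + ψ` of `t log t ψ` has integral zero over `(0, ∞)`, as both
boundary terms vanish. -/
theorem tMul_tPosInv : tMul tPosInv = heaviside := by
  ext ψ
  have hlim : Tendsto (fun t ↦ t * Real.log t * ψ t) atTop (𝓝 0) := by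
    have h := hasCompactSupport_mul_log_mul ψ
    rw [hasCompactSupport_iff_eventuallyEq, coclosedCompact_eq_cocompact] at h
    exact (h.filter_mono atTop_le_cocompact).tendsto
  have h := integral_Ioi_of_hasDerivAt_of_tendsto (a := 0)
    (continuous_mul_log_mul ψ).continuousWithinAt
    (fun t ht ↦ hasDerivAt_mul_log_mul ψ (ne_of_gt ht))
    ((integrable_log_mul_deriv_mulTest ψ).add (TestFun.integrable ψ)).integrableOn hlim
  rw [integral_add (integrable_log_mul_deriv_mulTest ψ).integrableOn
    (TestFun.integrable ψ).integrableOn] at h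
  simp only [zero_mul, sub_zero] at h
  rw [tMul_apply, tPosInv_apply, heaviside_apply, eq_neg_of_add_eq_zero_right h,
    Complex.ofReal_neg, ← integral_complex_ofReal]
  simp

theorem tMul_tNegInv : tMul tNegInv = constDistr 1 - heaviside := by
  ext ψ
  have hlim : Tendsto (fun t ↦ t * Real.log t * ψ t) atBot (𝓝 0) := by
    have h := hasCompactSupport_mul_log_mul ψ
    rw [hasCompactSupport_iff_eventuallyEq, coclosedCompact_eq_cocompact] at h
    exact (h.filter_mono atBot_le_cocompact).tendsto
  have h := integral_Iic_of_hasDerivAt_of_tendsto (a := 0)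
    (continuous_mul_log_mul ψ).continuousWithinAt
    (fun t ht ↦ hasDerivAt_mul_log_mul ψ (ne_of_lt ht))
    ((integrable_log_mul_deriv_mulTest ψ).add (TestFun.integrable ψ)).integrableOn hlim
  rw [integral_add (integrable_log_mul_deriv_mulTest ψ).integrableOn
    (TestFun.integrable ψ).integrableOn] at h
  simp only [zero_mul, sub_zero] at h
  have hsplit := intervalIntegral.integral_Iic_add_Ioi (b := 0)
    (TestFun.integrable ψ).integrableOn (TestFun.integrable ψ).integrableOn
  change _ = constDistr 1 ψ - heaviside ψ
  rw [tMul_apply, tNegInv_apply, heaviside_apply, constDistr_apply, one_mul, ← hsplit,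
    Complex.ofReal_add, add_sub_cancel_right, eq_neg_of_add_eq_zero_right h,
    ← integral_Iic_eq_integral_Iio, Complex.ofReal_neg, ← integral_complex_ofReal]
  simp

/-! ### Solving the Euler equation -/

theorem tMul_add (u v : Distr) : tMul (u + v) = tMul u + tMul v := rfl

theorem tMul_sub (u v : Distr) : tMul (u - v) = tMul u - tMul v := rfl

theorem tMul_smul (c : ℂ) (u : Distr) : tMul (c • u) = c • tMul u := rfl

theorem tMul_dirac : tMul dirac = 0 := by
  ext ψ
  rw [tMul_apply, dirac_apply, mulTest_apply]
  simp

theorem smul_constDistr_one (c : ℂ) : c • constDistr 1 = constDistr c := by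
  ext ψ
  change c * constDistr 1 ψ = _
  rw [constDistr_apply, constDistr_apply, one_mul]

theorem constDistr_eq_zero_iff (d : ℂ) : constDistr d = 0 ↔ d = 0 := by
  refine ⟨fun h ↦ ?_, fun h ↦ by
    ext ψ
    rw [h, constDistr_apply, zero_mul]
    rfl⟩
  obtain ⟨χ, -, hχ⟩ := exists_testFun_integral_eq_one
  simpa [constDistr_apply, hχ] using congr($h χ)

theorem tMul_smul_tPosInv_add_smul_tNegInv_add_smul_dirac (c a : ℂ) :
    tMul (c • tPosInv + (c - 1) • tNegInv + a • dirac) = heaviside + constDistr (c - 1) := by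
  rw [tMul_add, tMul_add, tMul_smul, tMul_smul, tMul_smul, tMul_tPosInv, tMul_tNegInv, tMul_dirac,
    ← smul_constDistr_one (c - 1)]
  module

/-- The Euler equation `t u' + u = δ₀` says that `t u` is a primitive of `δ₀`. -/
theorem tMul_lineDerivOp_add_self_eq_dirac_iff (u : Distr) :
    tMul (∂_{(1 : ℝ)} u) + u = dirac ↔ ∃ d : ℂ, tMul u = heaviside + constDistr d := by
  rw [← lineDerivOp_tMul]
  constructor
  · intro h
    obtain ⟨d, hd⟩ := exists_eq_constDistr_of_lineDerivOp_eq_zero (u := tMul u - heaviside)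
      (by rw [sub_eq_add_neg, LineDeriv.lineDerivOp_add, LineDeriv.lineDerivOp_neg, h,
        lineDerivOp_heaviside, add_neg_cancel])
    exact ⟨d, by rw [← hd]; abel⟩
  · rintro ⟨d, hd⟩
    rw [hd, LineDeriv.lineDerivOp_add, lineDerivOp_heaviside, lineDerivOp_constDistr, add_zero]

theorem tMul_lineDerivOp_add_self_eq_dirac_iff_exists (u : Distr) :
    tMul (∂_{(1 : ℝ)} u) + u = dirac ↔
      ∃ c a : ℂ, u = c • tPosInv + (c - 1) • tNegInv + a • dirac := by
  rw [tMul_lineDerivOp_add_self_eq_dirac_iff]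
  constructor
  · rintro ⟨d, hd⟩
    -- The choice `c = d + 1` makes `t` times the particular solution equal to `θ + d`.
    obtain ⟨a, ha⟩ := exists_eq_smul_dirac_of_tMul_eq_zero
      (u := u - ((d + 1) • tPosInv + (d + 1 - 1) • tNegInv + (0 : ℂ) • dirac))
      (by rw [tMul_sub, tMul_smul_tPosInv_add_smul_tNegInv_add_smul_dirac, hd, add_sub_cancel_right,
        sub_self])
    refine ⟨d + 1, a, ?_⟩
    rw [sub_eq_iff_eq_add] at ha
    rw [ha]
    module
  · rintro ⟨c, a, rfl⟩
    exact ⟨c - 1, tMul_smul_tPosInv_add_smul_tNegInv_add_smul_dirac c a⟩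

/-- `θ + d` equals `1` on `(0, ∞)` if and only if `d = 0`. -/
theorem isVanishingOn_heaviside_add_constDistr_sub_one_iff (d : ℂ) :
    Distribution.IsVanishingOn (heaviside + constDistr d - constDistr 1) (Ioi (0 : ℝ)) ↔ d = 0 := by
  -- On such `ψ` the distributions `θ` and `1` agree, so only the constant `d` survives.
  have key : ∀ ψ : TestFun, tsupport ψ ⊆ Ioi 0 →
      (heaviside + constDistr d - constDistr 1) ψ = d * ((∫ t, ψ t : ℝ) : ℂ) := fun ψ hψ ↦ by
    change heaviside ψ + constDistr d ψ - constDistr 1 ψ = _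
    rw [heaviside_apply, constDistr_apply, constDistr_apply,
      setIntegral_eq_integral_of_forall_compl_eq_zero fun t ht ↦
        image_eq_zero_of_notMem_tsupport fun h ↦ ht (hψ h)]
    ring
  constructor
  · intro h
    obtain ⟨χ, hs, hχ⟩ := exists_testFun_integral_eq_one
    have := h χ hs
    rw [key χ hs, hχ] at this
    simpa using this
  · rintro rfl ψ hψ
    rw [key ψ hψ, zero_mul]

end EulerDistribution

theorem mainTheorem3 :
    (∀ u : Distr, tMul (∂_{(1 : ℝ)} u) + u = dirac ↔
      ∃ c a₀ : ℂ, u = c • tPosInv + (c - 1) • tNegInv + a₀ • dirac) ∧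
    (∀ c a₀ : ℂ, tMul (c • tPosInv + (c - 1) • tNegInv + a₀ • dirac) =
      heaviside + constDistr (c - 1)) ∧
    (∀ φ : Distr, tMul (∂_{(1 : ℝ)} φ) + φ = dirac →
      ∃ d : ℂ, tMul φ = heaviside + constDistr d ∧
        (tMul φ = heaviside ↔ d = 0) ∧
        (Distribution.IsVanishingOn (tMul φ - constDistr 1) (Ioi (0 : ℝ)) ↔ d = 0)) ∧
    (∀ d : ℂ, ∃ φ : Distr, tMul (∂_{(1 : ℝ)} φ) + φ = dirac ∧
      tMul φ = heaviside + constDistr d) := by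
  refine ⟨tMul_lineDerivOp_add_self_eq_dirac_iff_exists,
    tMul_smul_tPosInv_add_smul_tNegInv_add_smul_dirac, fun φ hφ ↦ ?_, fun d ↦ ?_⟩
  · obtain ⟨d, hd⟩ := (tMul_lineDerivOp_add_self_eq_dirac_iff φ).1 hφ
    refine ⟨d, hd, ?_, ?_⟩
    · rw [hd, add_eq_left, constDistr_eq_zero_iff]
    · rw [hd]
      exact isVanishingOn_heaviside_add_constDistr_sub_one_iff d
  · have h := tMul_smul_tPosInv_add_smul_tNegInv_add_smul_dirac (d + 1) 0
    rw [add_sub_cancel_right] at h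
    exact ⟨_, (tMul_lineDerivOp_add_self_eq_dirac_iff _).2 ⟨d, h⟩, h⟩
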